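/- Let $a\ge 1$. For $\pi\in S_n$, say that $\pi$ has a descent at position $i$ ($1\le i<n$) if $\pi(i)>\pi(i+1)$; by convention every $\pi\in S_n$ also has a descent at position $n$. For $\vec b=(b_1,\dots,b_a)$ with $b_i\ge 0$ and $\vec n=(n_1,n_2,\dots)$ a finitely supported sequence with $n_j\ge 0$, let $A_{\vec b,\vec n}$ be the number of permutations on $b_1+\cdots+b_a$ letters whose descent set is contained in $\{b_1,b_1+b_2,\dots,b_1+\cdots+b_a\}$ and which have exactly $n_j$ $j$-cycles for every $j\ge 1$ (fixed points being $1$-cycles). For $r_1,\dots,r_a\ge 0$ with $n=r_1+\cdots+r_a\ge 1$ put \[ M(r_1,\dots,r_a)=\frac1n\sum_{d\mid n,r_1,\dots,r_a}\mu(d)\,\frac{(n/d)!}{(r_1/d)!\cdots(r_a/d)!}, \] the sum being over the common positive divisors $d$ of $n,r_1,\dots,r_a$, and $\mu$ the Möbius function. Then every $M(r_1,\dots,r_a)$ is a nonnegative integer, and in the ring of formal power series with integer coefficients in the variables $z_1,\dots,z_a,x_1,x_2,\dots$, \[ \sum_{\vec b,\vec n}A_{\vec b,\vec n}\prod_{i=1}^a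 z_i^{b_i}\prod_{j\ge1}x_j^{n_j}=\prod_{i=1}^{\infty}\ \prod_{\substack{r_1,\dots,r_a\ge 0\\ r_1+\cdots+r_a=i}}\left(\frac{1}{1-z_1^{r_1}\cdots z_a^{r_a}x_i}\right)^{M(r_1,\dots,r_a)}, \] where the infinite product converges coefficientwise (each coefficient of the partial products is eventually constant). -/

import Mathlib

open scoped MvPowerSeries.WithPiTopology

/-- The descent set of `π ∈ S_n`, as a set of positions `1, …, n`. Positions are numbered from `1`
while `Fin n` starts at `0`, so position `k` is the index `i` with `i + 1 = k`, and the next position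
is the index `j` with `j = k`. By convention every permutation has a descent at position `n`. -/
def descentSet {n : ℕ} (π : Equiv.Perm (Fin n)) : Set ℕ :=
  {k | k = n ∨ ∃ i j : Fin n, (i : ℕ) + 1 = k ∧ (j : ℕ) = k ∧ π j < π i}

/-- The set `{b₁, b₁ + b₂, …, b₁ + ⋯ + b_a}`. -/
def partialSums {a : ℕ} (b : Fin a → ℕ) : Set ℕ :=
  {s | ∃ j : Fin a, s = ∑ i ∈ Finset.Iic j, b i}

/-- The number of `j`-cycles of `π`; fixed points are the `1`-cycles. -/
def numCycles {n : ℕ} (π : Equiv.Perm (Fin n)) (j : ℕ+) : ℕ :=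
  π.partition.parts.count (j : ℕ)

/-- `A_{b,n}`: the number of permutations on `b₁ + ⋯ + b_a` letters with descent set contained in
`{b₁, b₁ + b₂, …, b₁ + ⋯ + b_a}` and with `n_j` `j`-cycles for every `j ≥ 1`. -/
noncomputable def countA {a : ℕ} (b : Fin a → ℕ) (n : ℕ+ → ℕ) : ℕ :=
  Nat.card {π : Equiv.Perm (Fin (∑ i, b i)) //
    descentSet π ⊆ partialSums b ∧ ∀ j : ℕ+, numCycles π j = n j}

/-- `M(r₁, …, r_a) = (1/n) ∑_{d ∣ n, r₁, …, r_a} μ(d) (n/d)! / ((r₁/d)! ⋯ (r_a/d)!)`,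
where `n = r₁ + ⋯ + r_a`. -/
def necklaceM {a : ℕ} (r : Fin a → ℕ) : ℚ :=
  1 / ((∑ i, r i : ℕ) : ℚ) *
    ∑ d ∈ (∑ i, r i).divisors with ∀ i, d ∣ r i,
      (ArithmeticFunction.moebius d : ℚ) *
        ((((∑ i, r i) / d).factorial : ℚ) / ∏ i, ((r i / d).factorial : ℚ))

/-- The formal power series `∑ A_{b,n} ∏ z_i ^ b_i ∏ x_j ^ n_j` in the variables
`z_i = X (Sum.inl i)`, for `i : Fin a`, and `x_j = X (Sum.inr j)`, for `j ≥ 1`,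
given by its coefficients. -/
noncomputable def cycleDescentSeries (a : ℕ) : MvPowerSeries (Fin a ⊕ ℕ+) ℤ :=
  fun e => (countA (fun i => e (Sum.inl i)) (fun j => e (Sum.inr j)) : ℤ)

/-- The monomial `z₁ ^ r₁ ⋯ z_a ^ r_a x_i`. -/
noncomputable def necklaceMonomial {a : ℕ} (r : Fin a → ℕ) (i : ℕ+) :
    MvPowerSeries (Fin a ⊕ ℕ+) ℤ :=
  (∏ k, MvPowerSeries.X (Sum.inl k) ^ r k) * MvPowerSeries.X (Sum.inr i)

/-- The formal power series `1 / (1 - z₁ ^ r₁ ⋯ z_a ^ r_a x_i)`; the constant term of the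
denominator is `1`. -/
noncomputable def necklaceFactor {a : ℕ} (r : Fin a → ℕ) (i : ℕ+) :
    MvPowerSeries (Fin a ⊕ ℕ+) ℤ :=
  MvPowerSeries.invOfUnit (1 - necklaceMonomial r i) 1

/-- `necklaceFactor r i` is the multiplicative inverse of `1 - z₁ ^ r₁ ⋯ z_a ^ r_a x_i`. -/
theorem one_sub_mul_necklaceFactor {a : ℕ} (r : Fin a → ℕ) (i : ℕ+) :
    (1 - necklaceMonomial r i) * necklaceFactor r i = 1 := by
  apply MvPowerSeries.mul_invOfUnit
  simp [necklaceMonomial]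

/-! This is the Gessel–Reutenauer bijection followed by a count of primitive necklaces. Colour the
positions weakly increasingly, with `b i` positions of colour `i`; the descent condition says
exactly that the permutation increases on each colour class. Attach to each point its itinerary, the
infinite word of colours met along its orbit. Increase on classes makes itineraries weakly
increasing in the point, for the lexicographic order, and gives each the same minimal period as its
point. The multiset of itineraries is thus shift-invariant and records `b` through first letters and
the cycle type through periods. It also determines `π`: sorting it recovers the itinerary map, and
`π⁻¹` is the stable sort of the shifted words. The same sort builds a permutation from any
admissible multiset (`countA_eq_ncard_invariantMultisets`).

A finite shift-invariant multiset is a unique nonnegative combination of primitive necklaces, i.e.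
shift orbits of periodic words. A necklace of length `i` and content `r` therefore contributes a
geometric series in `z^r x_i`, and the generating function is the product of these
(`hasProd_necklaceFactor`).

The words of period `∑ i, r i` with content `r` are counted by a multinomial coefficient.
Classifying them by minimal period and applying Möbius inversion identifies the number of necklaces
of content `r` with `M(r)` (`cast_necklaceCount`), which gives integrality and nonnegativity at
once. -/

/-- Infinite words over the alphabet `Fin a`, ordered lexicographically. -/
abbrev Word (a : ℕ) : Type := Lex (ℕ → Fin a)

/-! ### Lexicographic order and the shift; sorted enumerations of multisets. -/

namespace Word

variable {a : ℕ}

/-- The shift map, which deletes the first letter. -/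
def shift (w : Word a) : Word a := toLex fun k => w (k + 1)

theorem shift_apply (w : Word a) (k : ℕ) : shift w k = w (k + 1) := rfl

theorem iterate_shift_apply (w : Word a) (m k : ℕ) : shift^[m] w k = w (k + m) := by
  induction m generalizing w with
  | zero => rfl
  | succ m ih => rw [Function.iterate_succ_apply, ih, shift_apply, add_assoc]

theorem iterate_shift_apply_zero (w : Word a) (m : ℕ) : shift^[m] w 0 = w m := by
  rw [iterate_shift_apply, zero_add]

theorem lt_iff {v w : Word a} : v < w ↔ ∃ i, (∀ j < i, v j = w j) ∧ v i < w i := Iff.rfl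

theorem head_le_head {v w : Word a} (h : v ≤ w) : v 0 ≤ w 0 := by
  rcases h.eq_or_lt with rfl | h
  · exact le_rfl
  · obtain ⟨i, hi, hlt⟩ := lt_iff.1 h
    rcases Nat.eq_zero_or_pos i with rfl | hpos
    · exact hlt.le
    · exact (hi 0 hpos).le

theorem shift_le_shift {v w : Word a} (h : v ≤ w) (h0 : v 0 = w 0) : shift v ≤ shift w := by
  rcases h.eq_or_lt with rfl | h
  · exact le_rfl
  · obtain ⟨i, hi, hlt⟩ := lt_iff.1 h
    cases i with
    | zero => exact absurd h0 hlt.ne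
    | succ i => exact (lt_iff.2 ⟨i, fun j hj => hi (j + 1) (by omega), hlt⟩).le

end Word

theorem eq_of_monotone_of_map_univ_eq {N : ℕ} {α : Type*} [LinearOrder α] {f g : Fin N → α}
    (hf : Monotone f) (hg : Monotone g)
    (h : (Finset.univ : Finset (Fin N)).val.map f = Finset.univ.val.map g) : f = g := by
  rw [Fin.univ_val_map, Fin.univ_val_map, Multiset.coe_eq_coe] at h
  exact List.ofFn_injective (h.eq_of_pairwise' hf.sortedLE_ofFn.pairwise hg.sortedLE_ofFn.pairwise)

theorem exists_monotone_map_univ_eq {N : ℕ} {α : Type*} [LinearOrder α] {S : Multiset α}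
    (h : S.card = N) : ∃ f : Fin N → α, Monotone f ∧ Finset.univ.val.map f = S := by
  subst h
  induction S using Quotient.inductionOn with
  | h l =>
    refine ⟨l.get ∘ Tuple.sort l.get, Tuple.monotone_sort _, ?_⟩
    have h1 : (Finset.univ : Finset (Fin l.length)).val.map (Tuple.sort l.get)
        = Finset.univ.val := by
      simp
    have h2 : (Finset.univ : Finset (Fin l.length)).val.map (l.get ∘ Tuple.sort l.get)
        = Finset.univ.val.map l.get := by
      rw [← Multiset.map_map, h1]
    refine Eq.trans h2 ?_
    rw [Fin.univ_val_map, List.ofFn_get]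
    rfl

/-! ### Itineraries and the reconstruction of a permutation from them. -/

section Itinerary

variable {a N : ℕ}

/-- The word of the `c`-letters met by `p` under iteration of `π`. -/
def itinerary (c : Fin N → Fin a) (π : Equiv.Perm (Fin N)) (p : Fin N) : Word a :=
  toLex fun k => c ((π ^ k) p)

/-- The permutation `π` is increasing on each fibre of `c`. -/
def IncreasingOnFibers (c : Fin N → Fin a) (π : Equiv.Perm (Fin N)) : Prop :=
  ∀ p q, p < q → c p = c q → π p < π q

variable {c : Fin N → Fin a} {π : Equiv.Perm (Fin N)}

theorem itinerary_apply (p : Fin N) (k : ℕ) : itinerary c π p k = c ((π ^ k) p) := rfl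

theorem itinerary_zero (p : Fin N) : itinerary c π p 0 = c p := rfl

theorem semiconj_itinerary : Function.Semiconj (itinerary c π) π Word.shift := by
  intro p
  funext k
  change c ((π ^ k) (π p)) = c ((π ^ (k + 1)) p)
  rw [pow_succ, Equiv.Perm.mul_apply]

theorem IncreasingOnFibers.pow_lt_pow (hπ : IncreasingOnFibers c π) {p q : Fin N}
    (h : p < q) {m : ℕ} (hm : ∀ k < m, c ((π ^ k) p) = c ((π ^ k) q)) : (π ^ m) p < (π ^ m) q := by
  induction m with
  | zero => simpa using h
  | succ m ih =>
    rw [pow_succ', Equiv.Perm.mul_apply, Equiv.Perm.mul_apply]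
    exact hπ _ _ (ih fun k hk => hm k (by omega)) (hm m (by omega))

/-- Up to the first index where two itineraries differ the colours agree, so the iterates of the two
points are still in their original order there, and `c` is monotone. -/
theorem IncreasingOnFibers.monotone_itinerary (hπ : IncreasingOnFibers c π) (hc : Monotone c) :
    Monotone (itinerary c π) := by
  intro p q hpq
  rcases hpq.eq_or_lt with rfl | hpq
  · exact le_rfl
  by_contra hlt
  obtain ⟨i, hi, hlt⟩ := Word.lt_iff.1 (not_le.1 hlt)
  exact absurd (hc (hπ.pow_lt_pow hpq fun k hk => (hi k hk).symm).le) (not_le.2 hlt)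

/-- If `π ^ k` moved `p` while preserving its itinerary, iterating `π ^ k` would give a strictly
monotone infinite sequence in `Fin N`. -/
theorem IncreasingOnFibers.pow_apply_eq_of_itinerary_eq (hπ : IncreasingOnFibers c π) {p : Fin N}
    {k : ℕ} (h : itinerary c π ((π ^ k) p) = itinerary c π p) : (π ^ k) p = p := by
  have hc : ∀ m, c ((π ^ m) ((π ^ k) p)) = c ((π ^ m) p) := fun m => congrFun h m
  have step : ∀ n, (π ^ (k * n)) ((π ^ k) p) = (π ^ (k * (n + 1))) p := by
    intro n
    rw [mul_add, mul_one, pow_add, Equiv.Perm.mul_apply]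
  rcases lt_trichotomy p ((π ^ k) p) with hlt | heq | hlt
  · have : StrictMono fun n : ℕ => (π ^ (k * n)) p := by
      refine strictMono_nat_of_lt_succ fun n => ?_
      rw [← step]
      exact hπ.pow_lt_pow hlt fun m _ => (hc m).symm
    exact absurd this.injective (not_injective_infinite_finite _)
  · exact heq.symm
  · have : StrictAnti fun n : ℕ => (π ^ (k * n)) p := by
      refine strictAnti_nat_of_succ_lt fun n => ?_
      rw [← step]
      exact hπ.pow_lt_pow hlt fun m _ => hc m
    exact absurd this.injective (not_injective_infinite_finite _)

theorem IncreasingOnFibers.minimalPeriod_itinerary (hπ : IncreasingOnFibers c π) (p : Fin N) :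
    Function.minimalPeriod Word.shift (itinerary c π p) = Function.minimalPeriod π p := by
  rw [Function.minimalPeriod_eq_minimalPeriod_iff]
  intro k
  unfold Function.IsPeriodicPt Function.IsFixedPt
  rw [← semiconj_itinerary.iterate_right k, Equiv.Perm.iterate_eq_pow]
  exact ⟨hπ.pow_apply_eq_of_itinerary_eq, fun h => by rw [h]⟩

theorem itinerary_mem_periodicPts (p : Fin N) :
    itinerary c π p ∈ Function.periodicPts (Word.shift (a := a)) := by
  refine Function.mk_mem_periodicPts (orderOf_pos π) ?_
  unfold Function.IsPeriodicPt Function.IsFixedPt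
  rw [← semiconj_itinerary.iterate_right, Equiv.Perm.iterate_eq_pow, pow_orderOf_eq_one]
  rfl

/-- `Tuple.sort` is the stable sort, so besides monotonicity it must be checked that ties keep their
order. This makes `π` a function of its itineraries. -/
theorem IncreasingOnFibers.inv_eq_sort (hπ : IncreasingOnFibers c π) (hc : Monotone c) :
    π⁻¹ = Tuple.sort (Word.shift ∘ itinerary c π) := by
  have hcomp : (Word.shift ∘ itinerary c π) ∘ (π⁻¹ : Equiv.Perm (Fin N)) = itinerary c π := by
    funext p
    simp only [Function.comp_apply]
    rw [← semiconj_itinerary, Equiv.Perm.coe_inv, Equiv.apply_symm_apply]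
  rw [Tuple.eq_sort_iff]
  refine ⟨by rw [hcomp]; exact hπ.monotone_itinerary hc, fun i j hij h => ?_⟩
  -- The shift is injective on periodic words, so a tie between shifted words is a tie between the
  -- words; their first letters then agree, and `π` increases on that colour class.
  have heq : itinerary c π (π⁻¹ i) = itinerary c π (π⁻¹ j) := by
    obtain ⟨m, hm, h1⟩ := itinerary_mem_periodicPts (c := c) (π := π) (π⁻¹ i)
    obtain ⟨n, hn, h2⟩ := itinerary_mem_periodicPts (c := c) (π := π) (π⁻¹ j)
    exact h1.eq_of_apply_eq h2 hm hn h
  by_contra hle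
  rcases (not_lt.1 hle).eq_or_lt with he | hlt
  · exact hij.ne (π⁻¹.injective he.symm)
  · have := hπ _ _ hlt (congrFun heq 0).symm
    simp only [Equiv.Perm.coe_inv, Equiv.apply_symm_apply] at this
    exact absurd hij this.asymm

theorem IncreasingOnFibers.eq_of_itinerary_eq {π' : Equiv.Perm (Fin N)} (hc : Monotone c)
    (hπ : IncreasingOnFibers c π) (hπ' : IncreasingOnFibers c π')
    (h : itinerary c π = itinerary c π') : π = π' := by
  rw [← inv_inj, hπ.inv_eq_sort hc, hπ'.inv_eq_sort hc, h]

/-- The inverse construction. By shift invariance, stably sorting the shifted words returns the list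
`W` itself, so the inverse of the sorting permutation moves each point to one carrying the shifted
word. -/
theorem exists_increasingOnFibers_of_map_shift_eq {W : Fin N → Word a} (hW : Monotone W)
    (hinv : (Finset.univ.val.map W).map Word.shift = Finset.univ.val.map W)
    (hc : ∀ p, c p = W p 0) :
    ∃ π : Equiv.Perm (Fin N), IncreasingOnFibers c π ∧ itinerary c π = W := by
  set σ := Tuple.sort (Word.shift ∘ W) with hσ
  have hσW : (Word.shift ∘ W) ∘ σ = W := by
    refine eq_of_monotone_of_map_univ_eq (Tuple.monotone_sort _) hW ?_
    have h1 : (Finset.univ : Finset (Fin N)).val.map σ = Finset.univ.val := by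
      simp
    rw [← Multiset.map_map, h1, ← Multiset.map_map, hinv]
  have hstep : ∀ p, W (σ⁻¹ p) = Word.shift (W p) := by
    intro p
    conv_lhs => rw [← hσW]
    simp
  refine ⟨σ⁻¹, fun p q hpq hcpq => ?_, ?_⟩
  · have hle : Word.shift (W p) ≤ Word.shift (W q) :=
      Word.shift_le_shift (hW hpq.le) (by rw [← hc, ← hc, hcpq])
    rw [← hstep, ← hstep] at hle
    by_contra hcon
    rcases (not_lt.1 hcon).eq_or_lt with he | hlt
    · exact hpq.ne (σ⁻¹.injective he.symm)
    · have heq := le_antisymm hle (hW hlt.le)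
      -- Stability of the sort settles the case of equal shifted words.
      have := (Tuple.eq_sort_iff.1 hσ).2 _ _ hlt (by
        rw [Equiv.Perm.coe_inv] at heq hstep
        simp only [Function.comp_apply, Equiv.Perm.coe_inv, Equiv.apply_symm_apply]
        rw [← hstep, ← hstep, heq])
      simp only [Equiv.Perm.coe_inv, Equiv.apply_symm_apply] at this
      exact absurd hpq this.asymm
  · have hpow : ∀ k p, W ((σ⁻¹ ^ k) p) = Word.shift^[k] (W p) := by
      intro k
      induction k with
      | zero => intro p; rfl
      | succ k ih =>
        intro p
        rw [pow_succ, Equiv.Perm.mul_apply, ih, hstep, Function.iterate_succ_apply]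
    funext p k
    rw [itinerary_apply, hc, hpow, Word.iterate_shift_apply_zero]

end Itinerary

/-! ### Descent sets and block colourings. -/

section Blocks

variable {a : ℕ}

theorem exists_monotone_count_eq (b : Fin a → ℕ) :
    ∃ c : Fin (∑ i, b i) → Fin a, Monotone c ∧ ∀ i, (Finset.univ.val.map c).count i = b i := by
  obtain ⟨c, hc, h⟩ := exists_monotone_map_univ_eq (N := ∑ i, b i)
    (S := ∑ i, Multiset.replicate (b i) i) (by simp)
  refine ⟨c, hc, fun i => ?_⟩
  rw [h, Multiset.count_sum']
  simp [Multiset.count_replicate]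

variable {b : Fin a → ℕ} {c : Fin (∑ i, b i) → Fin a}

theorem lt_sum_Iic_iff (hc : Monotone c) (hcount : ∀ i, (Finset.univ.val.map c).count i = b i)
    (p : Fin (∑ i, b i)) (j : Fin a) : (p : ℕ) < ∑ i ∈ Finset.Iic j, b i ↔ c p ≤ j := by
  rw [← Tuple.lt_card_le_iff_apply_le_of_monotone (f := c) hc]
  have : ∑ i ∈ Finset.Iic j, b i = (Finset.univ.filter fun p => c p ≤ j).card := by
    rw [Finset.card_eq_sum_card_fiberwise (f := c) (t := Finset.Iic j)
      (by intro p hp; simpa using hp)]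
    refine Finset.sum_congr rfl fun i hi => ?_
    rw [← hcount, Multiset.count_map, Finset.filter_filter]
    change (Finset.univ.filter fun p => i = c p).card = _
    congr 1
    ext p
    simp only [Finset.mem_filter, Finset.mem_univ, true_and]
    constructor
    · rintro rfl
      exact ⟨Finset.mem_Iic.1 hi, rfl⟩
    · exact fun h => h.2.symm
  rw [this]

theorem descentSet_subset_partialSums_iff (ha : 1 ≤ a) (hc : Monotone c)
    (hcount : ∀ i, (Finset.univ.val.map c).count i = b i) (π : Equiv.Perm (Fin (∑ i, b i))) :
    descentSet π ⊆ partialSums b ↔ IncreasingOnFibers c π := by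
  have key := lt_sum_Iic_iff hc hcount
  constructor
  · intro h
    have step : ∀ (p q : Fin (∑ i, b i)), (p : ℕ) + 1 = q → c p = c q → π p < π q := by
      intro p q hpq hcpq
      by_contra hlt
      have hne : π q ≠ π p := fun he => by
        have := congrArg Fin.val (π.injective he)
        omega
      obtain ⟨j, hj⟩ := h (Or.inr ⟨p, q, hpq, rfl, lt_of_le_of_ne (not_lt.1 hlt) hne⟩)
      have h1 := (key p j).1 (by omega)
      rw [hcpq, ← key] at h1
      omega
    -- Colour classes are intervals since `c` is monotone, so comparisons of consecutive positions
    -- chain together.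
    have main : ∀ (d : ℕ) (p q : Fin (∑ i, b i)), (p : ℕ) + (d + 1) = q → c p = c q →
        π p < π q := by
      intro d
      induction d with
      | zero => exact fun p q hpq => step p q (by omega)
      | succ d ih =>
        intro p q hpq hcpq
        have hq := q.2
        have hlt : (p : ℕ) + (d + 1) < ∑ i, b i := by omega
        have h1 : c p ≤ c ⟨_, hlt⟩ := hc (Fin.le_def.2 (by simp))
        have h2 : c ⟨_, hlt⟩ ≤ c q := hc (Fin.le_def.2 (by simp only; omega))
        have h3 := le_antisymm h1 (hcpq ▸ h2)
        exact (ih p ⟨_, hlt⟩ rfl h3).trans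
          (step _ _ (by simp only; omega) (h3.symm.trans hcpq))
    intro p q hpq
    have := Fin.lt_def.1 hpq
    exact main (q - p - 1) p q (by omega)
  · rintro h k (rfl | ⟨p, q, hpk, hqk, hlt⟩)
    -- The conventional descent at the end is the last partial sum, which exists because `1 ≤ a`.
    · refine ⟨⟨a - 1, by omega⟩, ?_⟩
      congr 1
      ext i
      simp only [Finset.mem_univ, Finset.mem_Iic, true_iff, Fin.le_def]
      omega
    · refine ⟨c p, ?_⟩
      have hpq : p < q := Fin.lt_def.2 (by omega)
      have h1 := (key p (c p)).2 le_rfl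
      have h2 : ¬ c q ≤ c p := fun hle =>
        (h p q hpq (le_antisymm (hc hpq.le) hle)).asymm hlt
      rw [← key] at h2
      omega

end Blocks

/-! ### Cycle counts through minimal periods. -/

section Cycles

variable {N : ℕ} (π : Equiv.Perm (Fin N))

theorem minimalPeriod_perm_eq_card_support_cycleOf {p : Fin N} (hp : π p ≠ p) :
    Function.minimalPeriod π p = (π.cycleOf p).support.card := by
  have hcyc := Equiv.Perm.isCycle_cycleOf π hp
  rw [← hcyc.orderOf]
  apply Nat.dvd_antisymm
  · rw [← Function.isPeriodicPt_iff_minimalPeriod_dvd]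
    unfold Function.IsPeriodicPt Function.IsFixedPt
    rw [Equiv.Perm.iterate_eq_pow, ← Equiv.Perm.cycleOf_pow_apply_self, pow_orderOf_eq_one]
    rfl
  · rw [orderOf_dvd_iff_pow_eq_one, hcyc.pow_eq_one_iff]
    refine ⟨p, by rwa [Equiv.Perm.cycleOf_apply_self], ?_⟩
    rw [Equiv.Perm.cycleOf_pow_apply_self, ← Equiv.Perm.iterate_eq_pow]
    exact Function.isPeriodicPt_minimalPeriod π p

theorem card_minimalPeriod_eq (j : ℕ+) :
    (Finset.univ.filter fun p => Function.minimalPeriod π p = j).card = j * numCycles π j := by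
  unfold numCycles
  rw [Equiv.Perm.parts_partition, Multiset.count_add, Multiset.count_replicate]
  -- `cycleType` omits fixed points and `partition` adds them back as parts equal to `1`, hence the
  -- separate case.
  by_cases hj : (j : ℕ) = 1
  · rw [hj, if_pos rfl, Multiset.count_eq_zero_of_notMem
      (fun h => absurd (Equiv.Perm.one_lt_of_mem_cycleType h) (lt_irrefl _)), zero_add, one_mul,
      ← Finset.card_compl]
    congr 1
    ext p
    simp [Function.minimalPeriod_eq_one_iff_isFixedPt, Function.IsFixedPt]
  · rw [if_neg (fun h => hj h.symm), add_zero, Equiv.Perm.cycleType_def, Multiset.count_map]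
    change _ = j * (π.cycleFactorsFinset.filter fun τ => (j : ℕ) = τ.support.card).card
    rw [Finset.card_eq_sum_card_fiberwise (f := π.cycleOf)
      (t := π.cycleFactorsFinset.filter fun τ => (j : ℕ) = τ.support.card), mul_comm]
    · refine Finset.sum_const_nat fun τ hτ => ?_
      obtain ⟨hτ, hj'⟩ := Finset.mem_filter.1 hτ
      rw [hj']
      congr 1
      ext p
      simp only [Finset.mem_filter, Finset.mem_univ, true_and]
      rw [← Equiv.Perm.eq_cycleOf_of_mem_cycleFactorsFinset_iff π τ hτ]
      constructor
      · exact fun h => h.2.symm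
      · intro h
        refine ⟨?_, h.symm⟩
        rw [minimalPeriod_perm_eq_card_support_cycleOf, ← h]
        rwa [h, Equiv.Perm.cycleOf_mem_cycleFactorsFinset_iff, Equiv.Perm.mem_support] at hτ
    · intro p hp
      have hp : Function.minimalPeriod π p = j := by simpa using hp
      have hne : π p ≠ p := fun h => hj (by
        rw [← hp]; exact Function.minimalPeriod_eq_one_iff_isFixedPt.2 h)
      rw [Finset.mem_coe, Finset.mem_filter, Equiv.Perm.cycleOf_mem_cycleFactorsFinset_iff,
        Equiv.Perm.mem_support]
      exact ⟨hne, by rw [← hp, minimalPeriod_perm_eq_card_support_cycleOf _ hne]⟩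

end Cycles

/-- The finite shift-invariant multisets of words with `b i` words starting with the letter `i`
and, for each `j`, with `j * n j` words of minimal period `j`. -/
def invariantMultisets {a : ℕ} (b : Fin a → ℕ) (n : ℕ+ → ℕ) : Set (Multiset (Word a)) :=
  {S | S.map Word.shift = S ∧ (∀ i, S.countP (fun w => w 0 = i) = b i) ∧
    ∀ j : ℕ+, S.countP (fun w => Function.minimalPeriod Word.shift w = j) = j * n j}

/-- The bijection sends `π` to its multiset of itineraries. Injectivity: the itinerary map is the
sorted enumeration of that multiset, and it determines `π`. -/
theorem countA_eq_ncard_invariantMultisets {a : ℕ} (ha : 1 ≤ a) (b : Fin a → ℕ) (n : ℕ+ → ℕ) :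
    countA b n = (invariantMultisets b n).ncard := by
  obtain ⟨c, hc, hcount⟩ := exists_monotone_count_eq b
  have hdes := descentSet_subset_partialSums_iff ha hc hcount
  unfold countA
  rw [← Nat.card_coe_set_eq]
  have hper : ∀ π, IncreasingOnFibers c π → ∀ j : ℕ+,
      (Finset.univ.val.map (itinerary c π)).countP
        (fun w => Function.minimalPeriod Word.shift w = j) = j * numCycles π j := by
    intro π hπ j
    rw [← card_minimalPeriod_eq, Multiset.countP_map]
    simp only [hπ.minimalPeriod_itinerary]
    rfl
  have hmem : ∀ π : {π : Equiv.Perm (Fin (∑ i, b i)) //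
      descentSet π ⊆ partialSums b ∧ ∀ j : ℕ+, numCycles π j = n j},
      Finset.univ.val.map (itinerary c π.1) ∈ invariantMultisets b n := by
    rintro ⟨π, hd, hn⟩
    have hπ := (hdes π).1 hd
    refine ⟨?_, fun i => ?_, fun j => ?_⟩
    · have h1 : (Finset.univ : Finset (Fin (∑ i, b i))).val.map π = Finset.univ.val := by simp
      conv_rhs => rw [← h1]
      rw [Multiset.map_map, Multiset.map_map]
      refine Multiset.map_congr rfl fun p _ => (semiconj_itinerary p).symm
    · rw [← hcount i, Multiset.countP_map, Multiset.count_map]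
      congr 1
      refine Multiset.filter_congr fun p _ => ?_
      rw [itinerary_zero, eq_comm]
    · rw [hper π hπ, hn]
  refine Nat.card_eq_of_bijective (fun π => ⟨_, hmem π⟩) ⟨?_, ?_⟩
  · rintro ⟨π, hd, hn⟩ ⟨π', hd', hn'⟩ h
    have hπ := (hdes π).1 hd
    have hπ' := (hdes π').1 hd'
    refine Subtype.ext (hπ.eq_of_itinerary_eq hc hπ' ?_)
    exact eq_of_monotone_of_map_univ_eq (hπ.monotone_itinerary hc) (hπ'.monotone_itinerary hc)
      (congrArg Subtype.val h)
  · rintro ⟨S, hinv, hb, hn⟩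
    have hcount' : ∀ i, (S.map fun w => w 0).count i = b i := by
      intro i
      rw [← hb i, Multiset.count_map, Multiset.countP_eq_card_filter]
      congr 1
      exact Multiset.filter_congr fun w _ => eq_comm
    have hcard : S.card = ∑ i, b i := by
      rw [← Multiset.card_map (fun w : Word a => w 0) S]
      simp only [← hcount']
      rw [Multiset.sum_count_eq_card]
      exact fun _ _ => Finset.mem_univ _
    obtain ⟨W, hW, rfl⟩ := exists_monotone_map_univ_eq hcard
    -- The first letters of the sorted words are weakly increasing with letter counts `b`, which
    -- forces them to be `c`.
    have hcW : c = fun p => W p 0 := by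
      refine eq_of_monotone_of_map_univ_eq hc (fun p q h => Word.head_le_head (hW h)) ?_
      ext i
      rw [hcount, ← hcount', Multiset.map_map]
      rfl
    obtain ⟨π, hπ, rfl⟩ := exists_increasingOnFibers_of_map_shift_eq hW hinv (congrFun hcW)
    refine ⟨⟨π, (hdes π).2 hπ, fun j => ?_⟩, rfl⟩
    exact Nat.eq_of_mul_eq_mul_left j.pos ((hper π hπ j).symm.trans (hn j))

/-! ### Finite multisets invariant under a map. -/

section InvariantMultiset

open Function

variable {α : Type*} {f : α → α} {S : Multiset α}

theorem Multiset.iterate_mem_of_map_eq_self (h : S.map f = S) {x : α} (hx : x ∈ S) (k : ℕ) :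
    f^[k] x ∈ S := by
  induction k with
  | zero => exact hx
  | succ k ih =>
    rw [iterate_succ_apply', ← h]
    exact Multiset.mem_map_of_mem f ih

variable [DecidableEq α]

/-- The map sends the finite support onto itself, hence is injective on it. -/
theorem Multiset.injOn_of_map_eq_self (h : S.map f = S) : Set.InjOn f {x | x ∈ S} := by
  have him : S.toFinset.image f = S.toFinset := by
    rw [← Multiset.toFinset_map, h]
  have := Finset.injOn_of_card_image_eq (congrArg Finset.card him)
  intro x hx y hy
  exact this (by simpa using hx) (by simpa using hy)

theorem Multiset.mem_periodicPts_of_map_eq_self (h : S.map f = S) {x : α} (hx : x ∈ S) :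
    x ∈ periodicPts f := by
  let g : {x // x ∈ S.toFinset} → {x // x ∈ S.toFinset} := fun x => ⟨f x.1, by
    have := Multiset.iterate_mem_of_map_eq_self h (Multiset.mem_toFinset.1 x.2) 1
    simpa using this⟩
  have hg : Injective g := fun x y hxy => Subtype.ext
    (Multiset.injOn_of_map_eq_self h (Multiset.mem_toFinset.1 x.2) (Multiset.mem_toFinset.1 y.2)
      (congrArg Subtype.val hxy))
  obtain ⟨n, hn, hper⟩ := hg.mem_periodicPts ⟨x, Multiset.mem_toFinset.2 hx⟩
  have hsc : Semiconj (Subtype.val : {x // x ∈ S.toFinset} → α) g f := fun _ => rfl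
  exact ⟨n, hn, hper.map hsc⟩

theorem Multiset.count_iterate_of_map_eq_self (h : S.map f = S) {x : α} (hx : x ∈ periodicPts f)
    (k : ℕ) : S.count (f^[k] x) = S.count x := by
  by_cases hxS : x ∈ S
  · induction k with
    | zero => rfl
    | succ k ih =>
      rw [iterate_succ_apply', ← ih]
      conv_lhs => rw [← h]
      exact Multiset.count_map_eq_count f S (Multiset.injOn_of_map_eq_self h) _
        (Multiset.iterate_mem_of_map_eq_self h hxS k)
  · rw [Multiset.count_eq_zero_of_notMem hxS, Multiset.count_eq_zero]
    intro hmem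
    apply hxS
    obtain ⟨n, hn, hper⟩ := hx
    -- Here `n * k` is a multiple of the period `n` and is at least `k`, so this many further steps
    -- return to `x`.
    have : f^[n * k - k] (f^[k] x) = x := by
      rw [← iterate_add_apply, Nat.sub_add_cancel (Nat.le_mul_of_pos_left k hn)]
      exact hper.mul_const k
    rw [← this]
    exact Multiset.iterate_mem_of_map_eq_self h hmem _

end InvariantMultiset

/-! ### Periodic words and primitive necklaces. -/

namespace Word

open Function

variable {a : ℕ}

theorem isPeriodicPt_shift_iff {n : ℕ} {w : Word a} :
    IsPeriodicPt shift n w ↔ ∀ k, w (k + n) = w k := by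
  constructor
  · intro h k
    exact (iterate_shift_apply w n k).symm.trans (congrFun h k)
  · intro h
    funext k
    rw [iterate_shift_apply, h]

/-- A word of period `n > 0` is determined by its first `n` letters, which are arbitrary. -/
def periodicEquiv (a : ℕ) {n : ℕ} (hn : 0 < n) :
    {w : Word a // IsPeriodicPt shift n w} ≃ (Fin n → Fin a) where
  toFun w t := w.1 t
  invFun f := ⟨toLex fun k => f ⟨k % n, Nat.mod_lt k hn⟩, isPeriodicPt_shift_iff.2 fun k => by
    simp only [Pi.toLex_apply, Nat.add_mod_right]⟩
  left_inv w := by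
    refine Subtype.ext (funext fun k => ?_)
    change w.1 (k % n) = w.1 k
    rw [← iterate_shift_apply_zero w.1 (k % n), ← iterate_shift_apply_zero w.1 k,
      w.2.iterate_mod_apply]
  right_inv f := by
    funext t
    change f ⟨t % n, _⟩ = f t
    congr 1
    exact Fin.ext (Nat.mod_eq_of_lt t.2)

theorem finite_isPeriodicPt {n : ℕ} (hn : 0 < n) : {w : Word a | IsPeriodicPt shift n w}.Finite :=
  Set.finite_coe_iff.1 (Finite.of_equiv _ (periodicEquiv a hn).symm)

theorem finite_minimalPeriod (a n : ℕ) :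
    {w : Word a | 0 < n ∧ minimalPeriod shift w = n}.Finite := by
  rcases Nat.eq_zero_or_pos n with rfl | hn
  · simp
  · refine (finite_isPeriodicPt hn).subset ?_
    rintro w ⟨-, rfl⟩
    exact isPeriodicPt_minimalPeriod _ _

/-- The periodic words of minimal period `n`. -/
noncomputable def primitive (a n : ℕ) : Finset (Word a) := (finite_minimalPeriod a n).toFinset

theorem mem_primitive {n : ℕ} {w : Word a} :
    w ∈ primitive a n ↔ 0 < n ∧ minimalPeriod shift w = n := by
  simp [primitive]

/-- The orbit of a periodic word under the shift. -/
noncomputable def orbit (w : Word a) : Finset (Word a) :=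
  (Finset.range (minimalPeriod shift w)).image fun k => shift^[k] w

theorem mem_orbit {v w : Word a} (hw : w ∈ periodicPts shift) :
    v ∈ orbit w ↔ ∃ k, shift^[k] w = v := by
  simp only [orbit, Finset.mem_image, Finset.mem_range]
  constructor
  · rintro ⟨k, -, h⟩
    exact ⟨k, h⟩
  · rintro ⟨k, h⟩
    exact ⟨k % minimalPeriod shift w, Nat.mod_lt _ (minimalPeriod_pos_of_mem_periodicPts hw),
      by rw [iterate_mod_minimalPeriod_eq, h]⟩

theorem self_mem_orbit {w : Word a} (hw : w ∈ periodicPts shift) : w ∈ orbit w :=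
  (mem_orbit hw).2 ⟨0, rfl⟩

theorem injOn_iterate_shift (w : Word a) :
    Set.InjOn (fun k => shift^[k] w) (Finset.range (minimalPeriod shift w)) := by
  intro m hm n hn h
  exact iterate_injOn_Iio_minimalPeriod (by simpa using hm) (by simpa using hn) h

theorem card_orbit (w : Word a) : (orbit w).card = minimalPeriod shift w := by
  rw [orbit, Finset.card_image_of_injOn (injOn_iterate_shift w), Finset.card_range]

theorem iterate_mem_periodicPts {w : Word a} (hw : w ∈ periodicPts shift) (k : ℕ) :
    shift^[k] w ∈ periodicPts shift := by
  rw [← minimalPeriod_pos_iff_mem_periodicPts, minimalPeriod_apply_iterate hw]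
  exact minimalPeriod_pos_of_mem_periodicPts hw

theorem orbit_eq_of_mem_orbit {v w : Word a} (hw : w ∈ periodicPts shift) (h : v ∈ orbit w) :
    orbit v = orbit w := by
  obtain ⟨k, rfl⟩ := (mem_orbit hw).1 h
  refine Finset.eq_of_subset_of_card_le ?_ ?_
  · intro u hu
    obtain ⟨m, rfl⟩ := (mem_orbit (iterate_mem_periodicPts hw k)).1 hu
    exact (mem_orbit hw).2 ⟨m + k, iterate_add_apply _ _ _ _⟩
  · rw [card_orbit, card_orbit, minimalPeriod_apply_iterate hw]

/-- The primitive necklaces of length `n`, as shift orbits of periodic words. -/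
noncomputable def necklaces (a n : ℕ) : Finset (Finset (Word a)) := (primitive a n).image orbit

/-- The number of occurrences of each letter in a necklace. -/
def content (o : Finset (Word a)) (i : Fin a) : ℕ := (o.filter fun w => w 0 = i).card

theorem sum_content (o : Finset (Word a)) : ∑ i, content o i = o.card :=
  (Finset.card_eq_sum_card_fiberwise (f := fun w : Word a => w 0) (t := Finset.univ)
    (fun _ _ => Finset.mem_coe.2 (Finset.mem_univ _))).symm

variable {n : ℕ} {o : Finset (Word a)}

theorem primitive_subset_periodicPts {w : Word a} (h : w ∈ primitive a n) :
    w ∈ periodicPts shift := by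
  rw [← minimalPeriod_pos_iff_mem_periodicPts, (mem_primitive.1 h).2]
  exact (mem_primitive.1 h).1

theorem mem_iff_of_mem_necklaces (ho : o ∈ necklaces a n) {w : Word a} :
    w ∈ o ↔ w ∈ primitive a n ∧ orbit w = o := by
  obtain ⟨v, hv, rfl⟩ := Finset.mem_image.1 ho
  have hv' := primitive_subset_periodicPts hv
  constructor
  · intro hw
    refine ⟨?_, orbit_eq_of_mem_orbit hv' hw⟩
    obtain ⟨k, rfl⟩ := (mem_orbit hv').1 hw
    rw [mem_primitive, minimalPeriod_apply_iterate hv', ← mem_primitive]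
    exact hv
  · rintro ⟨hw, h⟩
    rw [← h]
    exact self_mem_orbit (primitive_subset_periodicPts hw)

theorem card_of_mem_necklaces (ho : o ∈ necklaces a n) : o.card = n := by
  obtain ⟨v, hv, rfl⟩ := Finset.mem_image.1 ho
  rw [card_orbit, (mem_primitive.1 hv).2]

theorem pos_of_mem_necklaces (ho : o ∈ necklaces a n) : 0 < n := by
  obtain ⟨v, hv, rfl⟩ := Finset.mem_image.1 ho
  exact (mem_primitive.1 hv).1

theorem nonempty_of_mem_necklaces (ho : o ∈ necklaces a n) : o.Nonempty := by
  rw [← Finset.card_pos, card_of_mem_necklaces ho]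
  exact pos_of_mem_necklaces ho

theorem map_shift_of_mem_necklaces (ho : o ∈ necklaces a n) : o.val.map shift = o.val := by
  have hinj : Set.InjOn shift (o : Set (Word a)) := by
    intro v hv w hw h
    obtain ⟨k, hk, hv⟩ := primitive_subset_periodicPts ((mem_iff_of_mem_necklaces ho).1 hv).1
    obtain ⟨l, hl, hw⟩ := primitive_subset_periodicPts ((mem_iff_of_mem_necklaces ho).1 hw).1
    exact hv.eq_of_apply_eq hw hk hl h
  rw [← Finset.image_val_of_injOn hinj]
  congr 1
  refine Finset.eq_of_subset_of_card_le ?_ (Finset.card_image_of_injOn hinj).ge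
  intro u hu
  obtain ⟨w, hw, rfl⟩ := Finset.mem_image.1 hu
  obtain ⟨hw', rfl⟩ := (mem_iff_of_mem_necklaces ho).1 hw
  exact (mem_orbit (primitive_subset_periodicPts hw')).2 ⟨1, rfl⟩

theorem card_primitive_filter_content (r : Fin a → ℕ) :
    ((primitive a n).filter fun w => content (orbit w) = r).card =
      n * ((necklaces a n).filter fun o => content o = r).card := by
  rw [Finset.card_eq_sum_card_fiberwise (f := orbit)
    (t := (necklaces a n).filter fun o => content o = r), mul_comm]
  · refine Finset.sum_const_nat fun o ho => ?_
    obtain ⟨ho, hr⟩ := Finset.mem_filter.1 ho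
    rw [← card_of_mem_necklaces ho]
    congr 1
    ext w
    rw [Finset.filter_filter, Finset.mem_filter, mem_iff_of_mem_necklaces ho]
    constructor
    · exact fun h => ⟨card_of_mem_necklaces ho ▸ h.1, h.2.2⟩
    · rintro ⟨h, rfl⟩
      exact ⟨by rwa [card_of_mem_necklaces ho], hr, rfl⟩
  · intro w hw
    obtain ⟨hw, hr⟩ := Finset.mem_filter.1 (Finset.mem_coe.1 hw)
    exact Finset.mem_coe.2 (Finset.mem_filter.2 ⟨Finset.mem_image_of_mem _ hw, hr⟩)

end Word

/-! ### Coefficients of products of geometric series. -/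

section Geometric

open MvPowerSeries

variable {σ : Type*}

theorem MvPowerSeries.coeff_invOfUnit_one_sub_monomial {v : σ →₀ ℕ} (hv : v ≠ 0) (l : σ →₀ ℕ)
    [Decidable (∃ k : ℕ, l = k • v)] :
    coeff l (invOfUnit (1 - monomial v (1 : ℤ)) 1) = if ∃ k : ℕ, l = k • v then 1 else 0 := by
  classical
  let φ : MvPowerSeries σ ℤ := fun l => if ∃ k : ℕ, l = k • v then 1 else 0
  have hφ : ∀ l, coeff l φ = if ∃ k : ℕ, l = k • v then 1 else 0 := fun _ => rfl
  have hconst : constantCoeff (1 - monomial v (1 : ℤ)) = ((1 : ℤˣ) : ℤ) := by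
    rw [map_sub, ← coeff_zero_eq_constantCoeff_apply, ← coeff_zero_eq_constantCoeff_apply,
      coeff_zero_one, coeff_monomial, if_neg hv.symm]
    simp
  have hmul : (1 - monomial v (1 : ℤ)) * φ = 1 := by
    ext l
    rw [sub_mul, one_mul, map_sub, coeff_monomial_mul, hφ, hφ, coeff_one, one_mul]
    by_cases hl : ∃ k : ℕ, l = k • v
    · rw [if_pos hl]
      obtain ⟨k, rfl⟩ := hl
      cases k with
      | zero =>
        rw [zero_smul, if_neg (fun h => hv (le_zero_iff.1 h)), if_pos rfl, sub_zero]
      | succ k =>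
        rw [add_smul, one_smul, if_pos le_add_self, add_tsub_cancel_right, if_pos ⟨k, rfl⟩,
          if_neg (fun h => hv (add_eq_zero.1 h).2), sub_self]
    · have h0 : l ≠ 0 := fun h => hl ⟨0, by rw [h, zero_smul]⟩
      rw [if_neg hl, if_neg h0]
      split_ifs with h1 h2
      · obtain ⟨k, hk⟩ := h2
        exact absurd ⟨k + 1, by rw [add_smul, one_smul, ← hk, tsub_add_cancel_of_le h1]⟩ hl
      · rfl
      · rfl
  have : invOfUnit (1 - monomial v (1 : ℤ)) 1 = φ := by
    calc _ = invOfUnit (1 - monomial v (1 : ℤ)) 1 * ((1 - monomial v (1 : ℤ)) * φ) := by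
          rw [hmul, mul_one]
      _ = φ := by rw [← mul_assoc, invOfUnit_mul _ _ hconst, one_mul]
  rw [this, hφ]
  congr

/-- Each factor is the geometric series in its monomial, so a term of the product is a choice of
multiplicities; `v i ≠ 0` makes the exponent `k i • v i` determine `k i`. -/
theorem MvPowerSeries.coeff_prod_invOfUnit_one_sub_monomial {ι : Type*} (s : Finset ι)
    {v : ι → σ →₀ ℕ} (hv : ∀ i ∈ s, v i ≠ 0) (e : σ →₀ ℕ) :
    coeff e (∏ i ∈ s, invOfUnit (1 - monomial (v i) (1 : ℤ)) 1) =
      ({k : ι →₀ ℕ | k.support ⊆ s ∧ ∑ i ∈ s, k i • v i = e}.ncard : ℤ) := by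
  classical
  rw [coeff_prod]
  have h1 : ∀ l ∈ Finset.finsuppAntidiag s e,
      ∏ i ∈ s, coeff (l i) (invOfUnit (1 - monomial (v i) (1 : ℤ)) 1) =
        if ∀ i ∈ s, ∃ k : ℕ, l i = k • v i then 1 else 0 := by
    intro l _
    rw [Finset.prod_congr rfl fun i hi => coeff_invOfUnit_one_sub_monomial (hv i hi) (l i),
      Finset.prod_ite_zero, Finset.prod_const_one]
  rw [Finset.sum_congr rfl h1, Finset.sum_boole]
  let F : (ι →₀ ℕ) → (ι →₀ σ →₀ ℕ) := fun k =>
    Finsupp.onFinset k.support (fun i => k i • v i) fun i hi => by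
      rw [Finsupp.mem_support_iff]
      rintro h
      exact hi (by rw [h, zero_smul])
  have hF : ∀ k i, F k i = k i • v i := fun _ _ => rfl
  have himage : F '' {k : ι →₀ ℕ | k.support ⊆ s ∧ ∑ i ∈ s, k i • v i = e} =
      ((Finset.finsuppAntidiag s e).filter fun l => ∀ i ∈ s, ∃ k : ℕ, l i = k • v i :
        Finset (ι →₀ σ →₀ ℕ)) := by
    ext l
    simp only [Set.mem_image, Set.mem_ofPred_eq, Finset.coe_filter, Finset.mem_finsuppAntidiag]
    constructor
    · rintro ⟨k, ⟨hk, rfl⟩, rfl⟩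
      exact ⟨⟨rfl, Finsupp.support_onFinset_subset.trans hk⟩, fun i _ => ⟨k i, rfl⟩⟩
    · rintro ⟨⟨hsum, hsupp⟩, h⟩
      choose! k hk using h
      have hval : ∀ i ∈ s, l i = k i • v i := hk
      refine ⟨Finsupp.onFinset s (fun i => if i ∈ s then k i else 0) (by
        intro i hi
        by_contra hcon
        exact hi (if_neg hcon)), ⟨Finsupp.support_onFinset_subset, ?_⟩, ?_⟩
      · rw [← hsum]
        refine Finset.sum_congr rfl fun i hi => ?_
        rw [hval i hi, Finsupp.onFinset_apply, if_pos hi]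
      · ext1 i
        rw [hF, Finsupp.onFinset_apply]
        split_ifs with hi
        · exact (hval i hi).symm
        · rw [zero_smul, Finsupp.notMem_support_iff.1 fun h => hi (hsupp h)]
  have hinj : Set.InjOn F {k : ι →₀ ℕ | k.support ⊆ s ∧ ∑ i ∈ s, k i • v i = e} := by
    rintro k ⟨hk, -⟩ k' ⟨hk', -⟩ h
    ext i
    by_cases hi : i ∈ s
    · obtain ⟨x, hx⟩ := Finsupp.ne_iff.1 (hv i hi)
      have := DFunLike.congr_fun (DFunLike.congr_fun h i) x
      rw [hF, hF, Finsupp.smul_apply, Finsupp.smul_apply, smul_eq_mul, smul_eq_mul] at this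
      exact Nat.eq_of_mul_eq_mul_right (Nat.pos_of_ne_zero hx) this
    · rw [Finsupp.notMem_support_iff.1 fun h => hi (hk h),
        Finsupp.notMem_support_iff.1 fun h => hi (hk' h)]
  rw [← hinj.ncard_image, himage, Set.ncard_coe_finset]

end Geometric

/-! ### Invariant multisets as combinations of necklaces, and the product formula. -/

section Decomposition

open Function

variable {a : ℕ}

/-- The exponent of the monomial `z₁ ^ r₁ ⋯ z_a ^ r_a x_i`. -/
noncomputable def necklaceExponent (r : Fin a → ℕ) (i : ℕ+) : Fin a ⊕ ℕ+ →₀ ℕ :=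
  ∑ k, Finsupp.single (Sum.inl k) (r k) + Finsupp.single (Sum.inr i) 1

theorem necklaceExponent_inl (r : Fin a → ℕ) (i : ℕ+) (k : Fin a) :
    necklaceExponent r i (Sum.inl k) = r k := by
  rw [necklaceExponent, Finsupp.add_apply, Finsupp.finsetSum_apply,
    Finset.sum_eq_single_of_mem k (Finset.mem_univ k)]
  · simp
  · intro l _ hl
    rw [Finsupp.single_eq_of_ne]
    exact fun h => hl (Sum.inl_injective h).symm

theorem necklaceExponent_inr (r : Fin a → ℕ) (i j : ℕ+) :
    necklaceExponent r i (Sum.inr j) = if i = j then 1 else 0 := by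
  rw [necklaceExponent, Finsupp.add_apply, Finsupp.finsetSum_apply, Finset.sum_eq_zero, zero_add]
  · simp [Finsupp.single_apply]
  · intro l _
    simp

theorem necklaceExponent_ne_zero (r : Fin a → ℕ) (i : ℕ+) : necklaceExponent r i ≠ 0 := by
  intro h
  have := DFunLike.congr_fun h (Sum.inr i)
  simp [necklaceExponent_inr] at this

theorem necklaceMonomial_eq_monomial (r : Fin a → ℕ) (i : ℕ+) :
    necklaceMonomial r i = MvPowerSeries.monomial (necklaceExponent r i) 1 := by
  simp only [necklaceMonomial, MvPowerSeries.X_pow_eq, MvPowerSeries.prod_monomial,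
    Finset.prod_const_one]
  rw [MvPowerSeries.X_def, MvPowerSeries.monomial_mul_monomial, one_mul]
  rfl

/-- The primitive necklaces with length in `s`, tagged by their length. -/
noncomputable def taggedNecklaces (a : ℕ) (s : Finset ℕ+) : Finset (Σ _ : ℕ+, Finset (Word a)) :=
  s.sigma fun i => Word.necklaces a i

/-- The multiset of words that contains each necklace `x` with multiplicity `k x`. -/
noncomputable def multisetOfNecklaces (s : Finset ℕ+) (k : (Σ _ : ℕ+, Finset (Word a)) →₀ ℕ) :
    Multiset (Word a) :=
  ∑ x ∈ taggedNecklaces a s, k x • x.2.val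

variable {s : Finset ℕ+} {x y : Σ _ : ℕ+, Finset (Word a)}

theorem mem_taggedNecklaces :
    x ∈ taggedNecklaces a s ↔ x.1 ∈ s ∧ x.2 ∈ Word.necklaces a x.1 := Finset.mem_sigma

theorem eq_of_mem_taggedNecklaces (hx : x ∈ taggedNecklaces a s) (hy : y ∈ taggedNecklaces a s)
    {w : Word a} (hwx : w ∈ x.2) (hwy : w ∈ y.2) : x = y := by
  obtain ⟨i, o⟩ := x
  obtain ⟨j, o'⟩ := y
  obtain ⟨h1, rfl⟩ := (Word.mem_iff_of_mem_necklaces (mem_taggedNecklaces.1 hx).2).1 hwx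
  obtain ⟨h2, rfl⟩ := (Word.mem_iff_of_mem_necklaces (mem_taggedNecklaces.1 hy).2).1 hwy
  rw [Word.mem_primitive] at h1 h2
  obtain rfl : i = j := PNat.coe_injective (h1.2.symm.trans h2.2)
  rfl

theorem countP_multisetOfNecklaces (k : (Σ _ : ℕ+, Finset (Word a)) →₀ ℕ) (P : Word a → Prop)
    [DecidablePred P] : (multisetOfNecklaces s k).countP P =
      ∑ x ∈ taggedNecklaces a s, k x * (x.2.filter P).card := by
  rw [multisetOfNecklaces, ← Multiset.coe_countPAddMonoidHom, map_sum]
  refine Finset.sum_congr rfl fun x _ => ?_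
  rw [Multiset.coe_countPAddMonoidHom, Multiset.countP_nsmul, Multiset.countP_eq_card_filter]
  rfl

theorem count_multisetOfNecklaces (k : (Σ _ : ℕ+, Finset (Word a)) →₀ ℕ)
    (hx : x ∈ taggedNecklaces a s) {w : Word a} (hw : w ∈ x.2) :
    (multisetOfNecklaces s k).count w = k x := by
  rw [multisetOfNecklaces, Multiset.count_sum', Finset.sum_eq_single_of_mem x hx]
  · rw [Multiset.count_nsmul, Multiset.count_eq_one_of_mem x.2.nodup hw, mul_one]
  · intro y hy hyx
    rw [Multiset.count_nsmul, Multiset.count_eq_zero_of_notMem, mul_zero]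
    exact fun h => hyx (eq_of_mem_taggedNecklaces hy hx h hw)

theorem count_multisetOfNecklaces_of_forall_notMem (k : (Σ _ : ℕ+, Finset (Word a)) →₀ ℕ)
    {w : Word a} (hw : ∀ x ∈ taggedNecklaces a s, w ∉ x.2) :
    (multisetOfNecklaces s k).count w = 0 := by
  rw [multisetOfNecklaces, Multiset.count_sum']
  refine Finset.sum_eq_zero fun x hx => ?_
  rw [Multiset.count_nsmul, Multiset.count_eq_zero_of_notMem (hw x hx), mul_zero]

theorem map_shift_multisetOfNecklaces (k : (Σ _ : ℕ+, Finset (Word a)) →₀ ℕ) :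
    (multisetOfNecklaces s k).map Word.shift = multisetOfNecklaces s k := by
  rw [multisetOfNecklaces, ← Multiset.coe_mapAddMonoidHom, map_sum]
  refine Finset.sum_congr rfl fun x hx => ?_
  rw [Multiset.coe_mapAddMonoidHom, Multiset.map_nsmul,
    Word.map_shift_of_mem_necklaces (mem_taggedNecklaces.1 hx).2]

theorem multisetOfNecklaces_mem_invariantMultisets_iff (k : (Σ _ : ℕ+, Finset (Word a)) →₀ ℕ)
    (e : Fin a ⊕ ℕ+ →₀ ℕ) :
    multisetOfNecklaces s k ∈ invariantMultisets (fun i => e (Sum.inl i)) (fun j => e (Sum.inr j)) ↔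
      ∑ x ∈ taggedNecklaces a s, k x • necklaceExponent (Word.content x.2) x.1 = e := by
  have hl : ∀ i, (multisetOfNecklaces s k).countP (fun w => w 0 = i) =
      (∑ x ∈ taggedNecklaces a s, k x • necklaceExponent (Word.content x.2) x.1) (Sum.inl i) := by
    intro i
    rw [countP_multisetOfNecklaces, Finsupp.finsetSum_apply]
    refine Finset.sum_congr rfl fun x _ => ?_
    rw [Finsupp.smul_apply, necklaceExponent_inl]
    rfl
  have hr : ∀ j : ℕ+, (multisetOfNecklaces s k).countP
      (fun w => minimalPeriod Word.shift w = j) = j *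
      (∑ x ∈ taggedNecklaces a s, k x • necklaceExponent (Word.content x.2) x.1) (Sum.inr j) := by
    intro j
    rw [countP_multisetOfNecklaces, Finsupp.finsetSum_apply, Finset.mul_sum]
    refine Finset.sum_congr rfl fun x hx => ?_
    have hx := (mem_taggedNecklaces.1 hx).2
    have hper : ∀ w ∈ x.2, minimalPeriod Word.shift w = x.1 := fun w hw =>
      (Word.mem_primitive.1 ((Word.mem_iff_of_mem_necklaces hx).1 hw).1).2
    rw [Finsupp.smul_apply, necklaceExponent_inr]
    split_ifs with h
    · rw [Finset.filter_true_of_mem fun w hw => by rw [hper w hw, h],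
        Word.card_of_mem_necklaces hx, h, smul_eq_mul, mul_one, mul_comm]
    · rw [Finset.filter_false_of_mem fun w hw => by
        rw [hper w hw]; exact fun h' => h (PNat.coe_injective h')]
      simp
  constructor
  · rintro ⟨-, h1, h2⟩
    ext (i | j)
    · rw [← hl, h1]
    · exact Nat.eq_of_mul_eq_mul_left j.pos ((hr j).symm.trans (h2 j))
  · intro h
    rw [h] at hl hr
    exact ⟨map_shift_multisetOfNecklaces k, hl, hr⟩

theorem exists_eq_multisetOfNecklaces {b : Fin a → ℕ} {n : ℕ+ → ℕ} (hs : ∀ j, n j ≠ 0 → j ∈ s)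
    {S : Multiset (Word a)} (hS : S ∈ invariantMultisets b n) :
    ∃ k : (Σ _ : ℕ+, Finset (Word a)) →₀ ℕ, k.support ⊆ taggedNecklaces a s ∧
      multisetOfNecklaces s k = S := by
  obtain ⟨hinv, -, hn⟩ := hS
  -- Multiplicity in `S` is constant along a shift orbit, so the supremum over a necklace is just
  -- that common value, obtained without choosing a representative.
  refine ⟨Finsupp.onFinset (taggedNecklaces a s)
    (fun x => if x ∈ taggedNecklaces a s then x.2.sup fun w => S.count w else 0)
    (fun x hx => by by_contra hcon; exact hx (if_neg hcon)),
    Finsupp.support_onFinset_subset, ?_⟩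
  ext w
  by_cases hw : ∃ x ∈ taggedNecklaces a s, w ∈ x.2
  · obtain ⟨x, hx, hw⟩ := hw
    rw [count_multisetOfNecklaces _ hx hw, Finsupp.onFinset_apply, if_pos hx]
    obtain ⟨hwp, horb⟩ := (Word.mem_iff_of_mem_necklaces (mem_taggedNecklaces.1 hx).2).1 hw
    have hwp := Word.primitive_subset_periodicPts hwp
    refine le_antisymm (Finset.sup_le fun v hv => ?_) (Finset.le_sup (f := fun w => S.count w) hw)
    rw [← horb, Word.mem_orbit hwp] at hv
    obtain ⟨m, rfl⟩ := hv
    exact (Multiset.count_iterate_of_map_eq_self hinv hwp m).le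
  · push Not at hw
    rw [count_multisetOfNecklaces_of_forall_notMem _ hw, eq_comm, Multiset.count_eq_zero]
    intro hwS
    have hwp := Multiset.mem_periodicPts_of_map_eq_self hinv hwS
    have hpos := minimalPeriod_pos_of_mem_periodicPts hwp
    set j : ℕ+ := ⟨minimalPeriod Word.shift w, hpos⟩ with hj
    refine hw ⟨j, Word.orbit w⟩ (mem_taggedNecklaces.2 ⟨hs j fun h0 => ?_, ?_⟩)
      (Word.self_mem_orbit hwp)
    · have := hn j
      rw [h0, mul_zero, Multiset.countP_eq_zero] at this
      exact this w hwS rfl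
    · exact Finset.mem_image_of_mem _ (Word.mem_primitive.2 ⟨hpos, rfl⟩)

theorem ncard_invariantMultisets {e : Fin a ⊕ ℕ+ →₀ ℕ} (hs : ∀ j, e (Sum.inr j) ≠ 0 → j ∈ s) :
    (invariantMultisets (fun i => e (Sum.inl i)) (fun j => e (Sum.inr j))).ncard =
      {k : (Σ _ : ℕ+, Finset (Word a)) →₀ ℕ | k.support ⊆ taggedNecklaces a s ∧
        ∑ x ∈ taggedNecklaces a s, k x • necklaceExponent (Word.content x.2) x.1 = e}.ncard := by
  have himage : invariantMultisets (fun i => e (Sum.inl i)) (fun j => e (Sum.inr j)) =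
      multisetOfNecklaces s '' {k : (Σ _ : ℕ+, Finset (Word a)) →₀ ℕ |
        k.support ⊆ taggedNecklaces a s ∧
        ∑ x ∈ taggedNecklaces a s, k x • necklaceExponent (Word.content x.2) x.1 = e} := by
    ext S
    constructor
    · intro hS
      obtain ⟨k, hk, rfl⟩ := exists_eq_multisetOfNecklaces hs hS
      exact ⟨k, ⟨hk, (multisetOfNecklaces_mem_invariantMultisets_iff k e).1 hS⟩, rfl⟩
    · rintro ⟨k, ⟨-, hk⟩, rfl⟩
      exact (multisetOfNecklaces_mem_invariantMultisets_iff k e).2 hk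
  rw [himage, Set.InjOn.ncard_image]
  rintro k ⟨hk, -⟩ k' ⟨hk', -⟩ h
  ext x
  by_cases hx : x ∈ taggedNecklaces a s
  · obtain ⟨w, hw⟩ := Word.nonempty_of_mem_necklaces (mem_taggedNecklaces.1 hx).2
    rw [← count_multisetOfNecklaces k hx hw, h, count_multisetOfNecklaces k' hx hw]
  · rw [Finsupp.notMem_support_iff.1 fun h => hx (hk h),
      Finsupp.notMem_support_iff.1 fun h => hx (hk' h)]

/-- The number of primitive necklaces of content `r`. -/
noncomputable def necklaceCount (r : Fin a → ℕ) : ℕ :=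
  ((Word.necklaces a (∑ i, r i)).filter fun o => Word.content o = r).card

theorem prod_necklaceFactor_pow_eq (i : ℕ+) :
    ∏ r ∈ Finset.piAntidiag (Finset.univ : Finset (Fin a)) (i : ℕ),
      necklaceFactor r i ^ necklaceCount r =
    ∏ o ∈ Word.necklaces a i, necklaceFactor (Word.content o) i := by
  rw [← Finset.prod_fiberwise_of_maps_to (g := Word.content)
    (t := Finset.piAntidiag (Finset.univ : Finset (Fin a)) (i : ℕ))]
  · refine Finset.prod_congr rfl fun r hr => ?_
    have hsum : ∑ k, r k = i := by simpa using hr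
    rw [Finset.prod_congr rfl (g := fun _ => necklaceFactor r i)
      fun o ho => by rw [(Finset.mem_filter.1 ho).2], Finset.prod_const, necklaceCount, hsum]
  · intro o ho
    simp [Word.sum_content, Word.card_of_mem_necklaces ho]

theorem hasProd_necklaceFactor (ha : 1 ≤ a) :
    HasProd (fun i : ℕ+ => ∏ r ∈ Finset.piAntidiag (Finset.univ : Finset (Fin a)) (i : ℕ),
      necklaceFactor r i ^ necklaceCount r) (cycleDescentSeries a) := by
  simp only [prod_necklaceFactor_pow_eq]
  rw [HasProd, SummationFilter.unconditional_filter,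
    MvPowerSeries.WithPiTopology.tendsto_iff_coeff_tendsto]
  intro e
  refine tendsto_const_nhds.congr' ?_
  -- Once `s` contains every `j` for which `x_j` divides the monomial, necklaces of other lengths
  -- cannot contribute, so the coefficient is already final.
  filter_upwards [Filter.eventually_ge_atTop
    (e.support.preimage Sum.inr Sum.inr_injective.injOn)] with s hs
  have hs : ∀ j, e (Sum.inr j) ≠ 0 → j ∈ s := fun j hj => hs (by simpa using hj)
  have h1 : MvPowerSeries.coeff e (cycleDescentSeries a) =
      (countA (fun i => e (Sum.inl i)) (fun j => e (Sum.inr j)) : ℤ) := rfl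
  rw [h1, countA_eq_ncard_invariantMultisets ha, ncard_invariantMultisets hs,
    ← MvPowerSeries.coeff_prod_invOfUnit_one_sub_monomial _
      fun x _ => necklaceExponent_ne_zero _ _, taggedNecklaces, Finset.prod_sigma]
  simp only [necklaceFactor, necklaceMonomial_eq_monomial]

end Decomposition

/-! ### Counting necklaces by multinomial coefficients and Möbius inversion. -/

theorem ncard_card_fiber_eq_multinomial {α : Type*} [Fintype α] [DecidableEq α] {n : ℕ}
    {r : α → ℕ} (hr : ∑ i, r i = n) :
    {f : Fin n → α | ∀ i, (Finset.univ.filter fun t => f t = i).card = r i}.ncard =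
      Nat.multinomial Finset.univ r := by
  have key : ∀ k : α → ℕ, MvPolynomial.coeff (Finsupp.equivFunOnFinite.symm r)
      (∏ i, (MvPolynomial.X i : MvPolynomial α ℕ) ^ k i) = if k = r then 1 else 0 := by
    intro k
    have : ∏ i, (MvPolynomial.X i : MvPolynomial α ℕ) ^ k i =
        MvPolynomial.monomial (Finsupp.equivFunOnFinite.symm k) 1 := by
      rw [MvPolynomial.monomial_eq, map_one, one_mul, Finsupp.prod_fintype _ _ (by simp)]
      rfl
    rw [this, MvPolynomial.coeff_monomial]
    simp only [Finsupp.equivFunOnFinite.symm.injective.eq_iff]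
  -- Compare the coefficient of `X^r` in `(∑ X_i)^n` computed by expanding over functions and by the
  -- multinomial theorem.
  have h := Finset.sum_pow_eq_sum_piAntidiag Finset.univ
    (fun i : α => (MvPolynomial.X i : MvPolynomial α ℕ)) n
  rw [Fintype.sum_pow] at h
  have h := congrArg (MvPolynomial.coeff (Finsupp.equivFunOnFinite.symm r)) h
  rw [MvPolynomial.coeff_sum, MvPolynomial.coeff_sum] at h
  have hleft : ∀ f : Fin n → α, ∏ t, (MvPolynomial.X (f t) : MvPolynomial α ℕ) =
      ∏ i, MvPolynomial.X i ^ (Finset.univ.filter fun t => f t = i).card := by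
    intro f
    rw [← Finset.prod_fiberwise (g := f)]
    refine Finset.prod_congr rfl fun i _ => ?_
    rw [Finset.prod_congr rfl (g := fun _ => MvPolynomial.X i)
      fun t ht => by rw [(Finset.mem_filter.1 ht).2], Finset.prod_const]
  have hright : ∀ k : α → ℕ, MvPolynomial.coeff (Finsupp.equivFunOnFinite.symm r)
      ((Nat.multinomial Finset.univ k : MvPolynomial α ℕ) * ∏ i, MvPolynomial.X i ^ k i) =
      if k = r then Nat.multinomial Finset.univ r else 0 := by
    intro k
    rw [← nsmul_eq_mul, MvPolynomial.coeff_smul, key]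
    split_ifs with h
    · rw [h, smul_eq_mul, mul_one]
    · rw [smul_zero]
  simp only [hleft, key, hright] at h
  rw [Finset.sum_ite_eq', if_pos (by simpa using hr), Finset.sum_boole] at h
  rw [← h, Nat.cast_id, ← Set.ncard_coe_finset]
  simp [funext_iff]

namespace Word

open Function

variable {a : ℕ}

/-- The number of occurrences of the letter `i` among the first `n` letters of `w`. -/
def letterCount (w : Word a) (i : Fin a) (n : ℕ) : ℕ := Nat.count (fun t => ofLex w t = i) n

theorem letterCount_eq_card (w : Word a) (i : Fin a) (n : ℕ) :
    letterCount w i n = (Finset.univ.filter fun t : Fin n => ofLex w t = i).card := by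
  rw [letterCount, Nat.count_eq_card_filter_range, ← Nat.Iio_eq_range, ← Fin.map_valEmbedding_univ,
    Finset.filter_map, Finset.card_map]
  rfl

theorem content_orbit (w : Word a) (i : Fin a) :
    content (orbit w) i = letterCount w i (minimalPeriod shift w) := by
  rw [content, orbit, Finset.filter_image, Finset.card_image_of_injOn, letterCount,
    Nat.count_eq_card_filter_range]
  · exact congrArg Finset.card (Finset.filter_congr fun t _ =>
      iff_of_eq (congrArg (· = i) (iterate_shift_apply_zero w t)))
  · exact (injOn_iterate_shift w).mono fun x hx =>
      Finset.mem_coe.2 (Finset.mem_filter.1 (Finset.mem_coe.1 hx)).1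

theorem count_mul_period {w : Word a} {d : ℕ} (hw : IsPeriodicPt shift d w) (m : ℕ) (i : Fin a) :
    letterCount w i (d * m) = m * letterCount w i d := by
  induction m with
  | zero => rw [mul_zero, zero_mul, letterCount, Nat.count_zero]
  | succ m ih =>
    have : ∀ k, ofLex w (d * m + k) = ofLex w k := fun k => by
      rw [add_comm]
      exact isPeriodicPt_shift_iff.1 (hw.mul_const m) k
    rw [mul_add, mul_one, letterCount, Nat.count_add]
    simp only [this]
    rw [← letterCount, ← letterCount, ih]
    ring

/-- The words of period `∑ i, r i` in which the letter `i` occurs `r i` times per period. -/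
def periodicWithContent (r : Fin a → ℕ) : Set (Word a) :=
  {w | IsPeriodicPt shift (∑ i, r i) w ∧ ∀ i, letterCount w i (∑ i, r i) = r i}

theorem ncard_periodicWithContent {r : Fin a → ℕ} (hr : 0 < ∑ i, r i) :
    (periodicWithContent r).ncard = Nat.multinomial Finset.univ r := by
  rw [← ncard_card_fiber_eq_multinomial (r := r) rfl]
  refine Set.ncard_congr (fun w hw => periodicEquiv a hr ⟨w, hw.1⟩) ?_ ?_ ?_
  · rintro w ⟨hw, hc⟩ i
    rw [← hc i, letterCount_eq_card]
    rfl
  · intro v w hv hw h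
    exact congrArg Subtype.val ((periodicEquiv a hr).injective h)
  · intro f hf
    obtain ⟨⟨w, hw⟩, rfl⟩ := (periodicEquiv a hr).surjective f
    refine ⟨w, ⟨hw, fun i => ?_⟩, rfl⟩
    rw [letterCount_eq_card]
    exact hf i

/-- A word with this period repeats its primitive block `q` times, so `q` divides every `m * r i`;
as the `r i` have gcd `1`, `q` divides `m`, and `d = m / q`. -/
theorem mem_periodicWithContent_smul_iff {r : Fin a → ℕ} (hr : Finset.univ.gcd r = 1)
    {m : ℕ} (hm : 0 < m) {w : Word a} :
    w ∈ periodicWithContent (m • r) ↔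
      ∃ d ∈ m.divisors, minimalPeriod shift w = d * ∑ i, r i ∧ content (orbit w) = d • r := by
  have hsum : ∑ i, (m • r) i = m * ∑ i, r i := by
    simp [Finset.mul_sum]
  constructor
  · rintro ⟨hper, hc⟩
    rw [hsum] at hper hc
    obtain ⟨q, hq⟩ := hper.minimalPeriod_dvd
    have hcq : ∀ i, q * content (orbit w) i = m * r i := by
      intro i
      have := hc i
      rwa [hq, count_mul_period (isPeriodicPt_minimalPeriod _ _), ← content_orbit] at this
    have hqm : q ∣ m := by
      have : q ∣ Finset.univ.gcd fun i => m * r i :=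
        Finset.dvd_gcd fun i _ => ⟨_, (hcq i).symm⟩
      rwa [Finset.gcd_mul_left, hr, normalize_eq, mul_one] at this
    obtain ⟨d, rfl⟩ := hqm
    have hq0 : 0 < q := Nat.pos_of_mul_pos_right hm
    refine ⟨d, Nat.mem_divisors.2 ⟨Dvd.intro_left q rfl, hm.ne'⟩, ?_, funext fun i => ?_⟩
    · refine Nat.eq_of_mul_eq_mul_left hq0 ?_
      rw [← mul_assoc, hq, mul_comm]
    · refine Nat.eq_of_mul_eq_mul_left hq0 ?_
      rw [hcq, mul_assoc]
      rfl
  · rintro ⟨d, hd, hmin, hcont⟩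
    obtain ⟨q, rfl⟩ := (Nat.mem_divisors.1 hd).1
    have hlen : d * q * ∑ i, r i = minimalPeriod shift w * q := by
      rw [hmin]
      ring
    have hmp := isPeriodicPt_minimalPeriod shift w
    refine ⟨by rw [hsum, hlen]; exact hmp.mul_const q, fun i => ?_⟩
    rw [hsum, hlen, count_mul_period hmp, ← content_orbit, hcont]
    simp only [Pi.smul_apply, smul_eq_mul]
    ring

theorem multinomial_smul_eq_sum {r : Fin a → ℕ} (hr : Finset.univ.gcd r = 1)
    (hpos : 0 < ∑ i, r i) {m : ℕ} (hm : 0 < m) :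
    Nat.multinomial Finset.univ (m • r) =
      ∑ d ∈ m.divisors, (d * ∑ i, r i) * necklaceCount (d • r) := by
  have hsum : ∀ m, ∑ i, (m • r) i = m * ∑ i, r i := by
    simp [Finset.mul_sum]
  have hpos' : 0 < ∑ i, (m • r) i := by
    rw [hsum]
    positivity
  have hcover : periodicWithContent (m • r) = ↑(m.divisors.biUnion fun d =>
      (primitive a (d * ∑ i, r i)).filter fun w => content (orbit w) = d • r) := by
    ext w
    rw [mem_periodicWithContent_smul_iff hr hm]
    simp only [Finset.coe_biUnion, Finset.mem_coe, Set.mem_iUnion, Finset.mem_filter,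
      mem_primitive, exists_prop]
    refine exists_congr fun d => and_congr_right fun hd => and_congr_left fun _ => ?_
    have := Nat.pos_of_mem_divisors hd
    exact ⟨fun h => ⟨by positivity, h⟩, fun h => h.2⟩
  rw [← ncard_periodicWithContent hpos', hcover, Set.ncard_coe_finset, Finset.card_biUnion]
  · refine Finset.sum_congr rfl fun d _ => ?_
    rw [card_primitive_filter_content, necklaceCount, hsum]
  · intro d _ d' _ hne
    refine Finset.disjoint_left.2 fun w hw hw' => hne ?_
    have h1 := (mem_primitive.1 (Finset.mem_filter.1 hw).1).2
    have h2 := (mem_primitive.1 (Finset.mem_filter.1 hw').1).2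
    exact Nat.eq_of_mul_eq_mul_right hpos (h1.symm.trans h2)

end Word

/-- Write `r = g • r₀` with `r₀` of gcd `1`. The common divisors in `necklaceM` are then the
divisors of `g`, and `Word.multinomial_smul_eq_sum` becomes a divisor sum in the single variable
`m`, open to Möbius inversion at `m = g`. -/
theorem cast_necklaceCount {a : ℕ} {r : Fin a → ℕ} (hr : r ≠ 0) :
    (necklaceCount r : ℚ) = necklaceM r := by
  obtain ⟨i₀, hi₀⟩ := Function.ne_iff.1 hr
  obtain ⟨g, r₀, rfl, hg, hgcd⟩ : ∃ g r₀, r = g • r₀ ∧ g = Finset.univ.gcd r ∧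
      Finset.univ.gcd r₀ = 1 := by
    obtain ⟨r₀, hr₀, hgcd⟩ := Finset.extract_gcd r ⟨i₀, Finset.mem_univ i₀⟩
    exact ⟨_, r₀, funext fun i => hr₀ i (Finset.mem_univ i), rfl, hgcd⟩
  have hg0 : 0 < g := Nat.pos_of_ne_zero fun h => hi₀ (by simp [h])
  have hpos : 0 < ∑ i, r₀ i := by
    refine (Nat.pos_of_ne_zero fun h => hi₀ ?_).trans_le
      (Finset.single_le_sum (fun _ _ => Nat.zero_le _) (Finset.mem_univ i₀))
    simp [h]
  have hsum : ∀ m, ∑ i, (m • r₀) i = m * ∑ i, r₀ i := by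
    simp [Finset.mul_sum]
  have hmoebius := (ArithmeticFunction.sum_eq_iff_sum_mul_moebius_eq
    (f := fun d => (((d * ∑ i, r₀ i) * necklaceCount (d • r₀) : ℕ) : ℚ))
    (g := fun m => (Nat.multinomial Finset.univ (m • r₀) : ℚ))).1 (fun m hm => by
      rw [Word.multinomial_smul_eq_sum hgcd hpos hm, Nat.cast_sum]) g hg0
  have hdiv : ((∑ i, (g • r₀) i).divisors.filter fun d => ∀ i, d ∣ (g • r₀) i) = g.divisors := by
    ext d
    rw [Finset.mem_filter, Nat.mem_divisors, Nat.mem_divisors]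
    constructor
    · rintro ⟨-, h⟩
      have : d ∣ Finset.univ.gcd (g • r₀) := Finset.dvd_gcd fun i _ => h i
      rw [← hg] at this
      exact ⟨this, hg0.ne'⟩
    · rintro ⟨h, -⟩
      rw [hsum]
      exact ⟨⟨h.mul_right _, (Nat.mul_pos hg0 hpos).ne'⟩, fun i => h.mul_right _⟩
  rw [Nat.sum_divisorsAntidiagonal (fun x y =>
    (ArithmeticFunction.moebius x : ℚ) * (Nat.multinomial Finset.univ (y • r₀) : ℚ))] at hmoebius
  have hterm : ∀ d ∈ g.divisors, (Nat.multinomial Finset.univ ((g / d) • r₀) : ℚ) =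
      (((∑ i, (g • r₀) i) / d).factorial : ℚ) / ∏ i, (((g • r₀) i / d).factorial : ℚ) := by
    intro d hd
    obtain ⟨q, rfl⟩ := (Nat.mem_divisors.1 hd).1
    have hd0 := Nat.pos_of_mem_divisors hd
    have h1 : ∀ i, (d * q) • r₀ i / d = q * r₀ i := fun i => by
      rw [smul_eq_mul, mul_assoc, Nat.mul_div_cancel_left _ hd0]
    rw [hsum, mul_assoc, Nat.mul_div_cancel_left _ hd0, Nat.mul_div_cancel_left _ hd0, ← hsum,
      ← Nat.multinomial_spec, eq_div_iff]
    · simp only [Pi.smul_apply, h1]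
      push_cast
      exact mul_comm _ _
    · exact Finset.prod_ne_zero_iff.2 fun i _ => Nat.cast_ne_zero.2 (Nat.factorial_ne_zero _)
  rw [Finset.sum_congr rfl fun d hd => by rw [hterm d hd]] at hmoebius
  rw [necklaceM, hdiv, hmoebius, hsum]
  have : ((g * ∑ i, r₀ i : ℕ) : ℚ) ≠ 0 := Nat.cast_ne_zero.2 (Nat.mul_pos hg0 hpos).ne'
  rw [Nat.cast_mul (g * ∑ i, r₀ i)]
  field_simp

theorem corollary4 (a : ℕ) (ha : 1 ≤ a) :
    ∃ M : (Fin a → ℕ) → ℕ,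
      (∀ r : Fin a → ℕ, r ≠ 0 → (M r : ℚ) = necklaceM r) ∧
      HasProd
        (fun i : ℕ+ => ∏ r ∈ Finset.piAntidiag (Finset.univ : Finset (Fin a)) (i : ℕ),
          necklaceFactor r i ^ M r)
        (cycleDescentSeries a) :=
  ⟨necklaceCount, fun _ hr => cast_necklaceCount hr, hasProd_necklaceFactor ha⟩
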